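/- **Definitions.** For $n\ge 1$ let $C_{l,Lip}(\mathbb R^n)$ be the set of functions $\varphi:\mathbb R^n\to\mathbb R$ for which there are $C\in\mathbb R$, $m\in\mathbb N$ with $|\varphi(x)-\varphi(y)|\le C(1+|x|^m+|y|^m)|x-y|$ for all $x,y$. A *sublinear expectation space* $(\Omega,\mathcal H,\mathbb E)$ consists of a set $\Omega$, a linear space $\mathcal H$ of functions $\Omega\to\mathbb R$ which contains the constants and is closed under $X\mapsto|X|$ and under $(X_1,\dots,X_n)\mapsto\varphi(X_1,\dots,X_n)$ for $\varphi\in C_{l,Lip}(\mathbb R^n)$, and a functional $\mathbb E:\mathcal H\to\mathbb R$ which is monotone, preserves constants, is sub-additive, and satisfies $\mathbb E[\lambda X]=\lambda\mathbb E[X]$ for $\lambda>0$. Elements of $\mathcal H$ are called random variables. - $X$ and $Y$ (possibly on different spaces, with expectations $\mathbb E_1$, $\mathbb E_2$) are *identically distributed*, $X\overset{d}{=}Y$, if $\mathbb E_1[\varphi(X)]=\mathbb E_2[\varphi(Y)]$ for all $\varphi\in C_{l,Lip}(\mathbb R)$. - $Y$ is *independent of* $X$ if $\mathbb E[\varphi(X,Y)]=\mathbb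 E\big[\mathbb E[\varphi(x,Y)]\big|_{x=X}\big]$ for all $\varphi\in C_{l,Lip}(\mathbb R^2)$. An *independent copy* of $X$ is a $\overline X$ that is independent of $X$ with $\overline X\overset{d}{=}X$. - $\eta\overset{d}{=}M_{[a,b]}$ (maximal distribution) if $\mathbb E[\varphi(\eta)]=\sup_{x\in[a,b]}\varphi(x)$ for all $\varphi\in C_{l,Lip}(\mathbb R)$. - $\delta$ is *G-normally distributed* if $a\delta+b\overline\delta\overset{d}{=}\sqrt{a^2+b^2}\,\delta$ for all $a,b\ge0$, where $\overline\delta$ is an independent copy of $\delta$. (If the space carries no such copy, $\delta$ is replaced on the left by an identically distributed variable, with an independent copy $\overline\delta$ of it, on another sublinear expectation space.) If moreover $-\mathbb E[-\delta^2]=\underline\sigma^2$ and $\mathbb E[\delta^2]=\overline\sigma^2$, write $\delta\overset{d}{=}N(0,[\underline\sigma^2,\overline\sigma^2])$. **Theorem.** Let $(\Omega,\mathcal H,\mathbb E)$ be a sublinear expectation space, $\underline\mu,\overline\mu\in\mathbb R$, $0\le\underline\sigma\le\overline\sigma$, and let $M,M_1\overset{d}{=}M_{[\underline\mu,\overline\mu]}$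 and $\delta,\delta_1\overset{d}{=}N(0,[\underline\sigma^2,\overline\sigma^2])$ be random variables on it such that $M_1$ is independent of $M$ and $\delta_1$ is independent of $\delta$. Let $Z':\Omega\to\mathbb C$ satisfy $\mathrm{Re}(Z')=M+\delta$ and $\mathrm{Im}(Z')=M_1+\delta_1$. Then for every complex number $h=h_1+ih_2$ there are random variables $\widetilde M,\widetilde M_1,\widetilde\delta,\widetilde\delta_1\in\mathcal H$ with $\mathrm{Re}(hZ')=\widetilde M+\widetilde\delta$, $\mathrm{Im}(hZ')=\widetilde M_1+\widetilde\delta_1$, $$\widetilde\delta,\ \widetilde\delta_1\overset{d}{=}N(0,[|h|^2\underline\sigma^2,|h|^2\overline\sigma^2]),$$ $$\widetilde M\overset{d}{=}M_{[\underline\mu(h_1^++h_2^-)-\overline\mu(h_1^-+h_2^+),\ \overline\mu(h_1^++h_2^-)-\underline\mu(h_1^-+h_2^+)]},$$ $$\widetilde M_1\overset{d}{=}M_{[\underline\mu(h_1^++h_2^+)-\overline\mu(h_1^-+h_2^-),\ \overline\mu(h_1^++h_2^+)-\underline\mu(h_1^-+h_2^-)]},$$ where $x^+=\max(x,0)$ and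 $x^-=\max(-x,0)$. -/

import Mathlib

namespace SublinearExp

/-- The class `C_{l,Lip}(V)` of locally Lipschitz test functions with polynomial growth of the
local Lipschitz constant. -/
def IsLocLip {V : Type*} [NormedAddCommGroup V] (φ : V → ℝ) : Prop :=
  ∃ (C : ℝ) (m : ℕ), ∀ x y : V, |φ x - φ y| ≤ C * (1 + ‖x‖ ^ m + ‖y‖ ^ m) * ‖x - y‖

/-- A sublinear expectation space `(Ω, ℋ, 𝔼)`. The linear space of random variables is `H`; it
contains the constants and is stable under `|·|` and under composition with functions of class
`C_{l,Lip}(ℝⁿ)`. The functional `E` is only ever used on `H`: every axiom is restricted to `H`,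
and its values outside `H` carry no information. -/
structure SublinearSpace (Ω : Type*) where
  /-- the space of random variables -/
  H : Submodule ℝ (Ω → ℝ)
  const_mem : ∀ c : ℝ, (fun _ => c) ∈ H
  abs_mem : ∀ X ∈ H, (fun ω => |X ω|) ∈ H
  comp_mem : ∀ (n : ℕ) (X : Fin n → Ω → ℝ), (∀ i, X i ∈ H) →
    ∀ φ : (Fin n → ℝ) → ℝ, IsLocLip φ → (fun ω => φ (fun i => X i ω)) ∈ H
  /-- the sublinear expectation -/
  E : (Ω → ℝ) → ℝ
  mono : ∀ X ∈ H, ∀ Y ∈ H, (∀ ω, Y ω ≤ X ω) → E Y ≤ E X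
  const : ∀ c : ℝ, E (fun _ => c) = c
  subadd : ∀ X ∈ H, ∀ Y ∈ H, E (fun ω => X ω + Y ω) ≤ E X + E Y
  pos_homog : ∀ X ∈ H, ∀ c : ℝ, 0 < c → E (fun ω => c * X ω) = c * E X

/-- `X` on the first space and `Y` on the second space are identically distributed. -/
def IdentDistrib {Ω₁ Ω₂ : Type*} (S₁ : SublinearSpace Ω₁) (X : Ω₁ → ℝ)
    (S₂ : SublinearSpace Ω₂) (Y : Ω₂ → ℝ) : Prop :=
  ∀ φ : ℝ → ℝ, IsLocLip φ → S₁.E (fun ω => φ (X ω)) = S₂.E (fun ω => φ (Y ω))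

/-- `Y` is independent of `X` (the order matters):
`𝔼[φ(X, Y)] = 𝔼[ 𝔼[φ(x, Y)] |_{x = X} ]`. -/
def IsIndepOf {Ω : Type*} (S : SublinearSpace Ω) (Y X : Ω → ℝ) : Prop :=
  ∀ φ : ℝ × ℝ → ℝ, IsLocLip φ →
    S.E (fun ω => φ (X ω, Y ω)) = S.E (fun ω => S.E (fun ω' => φ (X ω, Y ω')))

/-- `Y` is an independent copy of `X`. -/
def IsIndepCopy {Ω : Type*} (S : SublinearSpace Ω) (Y X : Ω → ℝ) : Prop :=
  IsIndepOf S Y X ∧ IdentDistrib S Y S X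

/-- `η` has the maximal distribution `M_{[a,b]}`: `𝔼[φ(η)] = sup_{x ∈ [a,b]} φ(x)`. -/
def IsMaximal {Ω : Type*} (S : SublinearSpace Ω) (η : Ω → ℝ) (a b : ℝ) : Prop :=
  η ∈ S.H ∧ ∀ φ : ℝ → ℝ, IsLocLip φ →
    IsLUB (φ '' Set.Icc a b) (S.E (fun ω => φ (η ω)))

/-- `δ` is G-normally distributed: `aδ + bδ' =ᵈ √(a² + b²) δ` for all `a, b ≥ 0`, where `δ'` is an
independent copy of `δ`. The original space need not carry an independent copy of `δ`, so, as
usual, the pair (copy of `δ`, independent copy of it) is taken on some sublinear expectation space.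
The joint distribution of such a pair is determined by the distribution of `δ`, so the choice
of that space is immaterial; a suitable pair can always be realised on `ℝ × ℝ`. -/
def IsGNormal {Ω : Type*} (S : SublinearSpace Ω) (δ : Ω → ℝ) : Prop :=
  δ ∈ S.H ∧ ∃ (Ω' : Type) (S' : SublinearSpace Ω') (X X' : Ω' → ℝ),
    X ∈ S'.H ∧ X' ∈ S'.H ∧ IdentDistrib S' X S δ ∧ IsIndepCopy S' X' X ∧
    ∀ a b : ℝ, 0 ≤ a → 0 ≤ b →
      IdentDistrib S' (fun ω => a * X ω + b * X' ω) S (fun ω => √(a ^ 2 + b ^ 2) * δ ω)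

/-- `δ =ᵈ N(0, [vlo, vhi])`: `δ` is G-normally distributed with lower variance
`-𝔼[-δ²] = vlo` and upper variance `𝔼[δ²] = vhi`. -/
def IsGNormalVar {Ω : Type*} (S : SublinearSpace Ω) (δ : Ω → ℝ) (vlo vhi : ℝ) : Prop :=
  IsGNormal S δ ∧ -S.E (fun ω => -(δ ω) ^ 2) = vlo ∧ S.E (fun ω => (δ ω) ^ 2) = vhi

end SublinearExp

/-! Multiplication by `h` acts on the pairs (M, M₁) and (δ, δ₁) separately, so the witnesses are the
linear combinations with coefficients (`h.re`, `-h.im`) and (`h.im`, `h.re`). Independence within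
each pair suffices.

Maximal part: by independence, the expectation of φ(aM + bM₁) is an iterated supremum over a square,
whose image under (x, y) ↦ ax + by is the stated interval (`IsMaximal.add`).

G-normal part: stability is given only for nonnegative coefficients and for an independent copy of
the same variable. Signs, and the passage from δ₁ to δ, are handled by uniqueness: the two variances
determine a G-normal law (`IsGNormal.identDistrib`). Uniqueness is proved without the G-heat
equation. The operators f ↦ 𝔼[f(x + √t X)] form a semigroup (`IsGNormal.heat_add`), and G-normal
variables are centered. On functions with Lipschitz second derivative, two such semigroups with
equal variances differ by O(t^(3/2)) in one step, so N² steps of length N⁻² give an error O(1/N).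
Smoothing is by box averages, which pass outside a sublinear expectation with an inequality
(`heat_boxAvg_le`). Comparison in both directions then gives equality on Lipschitz functions, and
truncation extends it to all test functions. -/

namespace SublinearExp

/-! ### Closure properties of the test functions -/

section LocLip

variable {V W : Type*} [NormedAddCommGroup V] [NormedAddCommGroup W]

theorem IsLocLip.exists_nonneg {φ : V → ℝ} (hφ : IsLocLip φ) :
    ∃ (C : ℝ) (m : ℕ), 0 ≤ C ∧
      ∀ x y : V, |φ x - φ y| ≤ C * (1 + ‖x‖ ^ m + ‖y‖ ^ m) * ‖x - y‖ := by
  obtain ⟨C, m, h⟩ := hφ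
  refine ⟨|C|, m, abs_nonneg C, fun x y => (h x y).trans ?_⟩
  gcongr
  exact le_abs_self C

theorem IsLocLip.of_lipschitz {φ : V → ℝ} (L : ℝ) (h : ∀ x y, |φ x - φ y| ≤ L * ‖x - y‖) :
    IsLocLip φ := by
  refine ⟨|L|, 0, fun x y => (h x y).trans ?_⟩
  have h1 : L ≤ |L| * (1 + ‖x‖ ^ 0 + ‖y‖ ^ 0) := by
    have := le_abs_self L
    have := abs_nonneg L
    simp only [pow_zero]
    linarith
  gcongr

theorem pow_le_one_add_pow {t : ℝ} (ht : 0 ≤ t) {m n : ℕ} (h : m ≤ n) : t ^ m ≤ 1 + t ^ n := by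
  rcases le_total t 1 with h1 | h1
  · have := pow_le_one₀ (n := m) ht h1
    have := pow_nonneg ht n
    linarith
  · have := pow_le_pow_right₀ h1 h
    linarith

theorem IsLocLip.comp {φ : V → ℝ} (hφ : IsLocLip φ) (g : W → V) (K : ℝ)
    (hg : ∀ x y, ‖g x - g y‖ ≤ K * ‖x - y‖) : IsLocLip (fun x => φ (g x)) := by
  obtain ⟨C, m, hC, h⟩ := hφ.exists_nonneg
  set R := |K| + ‖g 0‖ with hR
  have hR0 : 0 ≤ R := by positivity
  -- A Lipschitz map grows at most like R(1 + ‖x‖), and convexity gives (1 + t)^m ≤ 2^(m-1)(1 +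
  -- t^m); with truncated subtraction this remains true at m = 0.
  set A := R ^ m * 2 ^ (m - 1) with hA
  have hA0 : 0 ≤ A := by positivity
  have hgx : ∀ x, ‖g x‖ ^ m ≤ A * (1 + ‖x‖ ^ m) := by
    intro x
    have h1 : ‖g x‖ ≤ R * (1 + ‖x‖) := by
      have h2 : ‖g x‖ ≤ ‖g x - g 0‖ + ‖g 0‖ := by
        simpa using norm_add_le (g x - g 0) (g 0)
      have h3 := hg x 0
      rw [sub_zero] at h3
      have h4 : K * ‖x‖ ≤ |K| * ‖x‖ := by gcongr; exact le_abs_self K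
      have h5 : 0 ≤ ‖g 0‖ * ‖x‖ := by positivity
      have h6 := abs_nonneg K
      rw [hR]
      linarith
    calc ‖g x‖ ^ m ≤ (R * (1 + ‖x‖)) ^ m := by gcongr
      _ = R ^ m * (1 + ‖x‖) ^ m := mul_pow _ _ _
      _ ≤ R ^ m * (2 ^ (m - 1) * (1 ^ m + ‖x‖ ^ m)) := by
          gcongr
          exact add_pow_le zero_le_one (norm_nonneg x) m
      _ = A * (1 + ‖x‖ ^ m) := by rw [hA, one_pow]; ring
  refine ⟨C * (1 + 2 * A) * |K|, m, fun x y => (h _ _).trans ?_⟩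
  have h1 := hgx x
  have h2 := hgx y
  have h3 : 1 + ‖g x‖ ^ m + ‖g y‖ ^ m ≤ (1 + 2 * A) * (1 + ‖x‖ ^ m + ‖y‖ ^ m) := by
    have : 0 ≤ ‖x‖ ^ m := by positivity
    have : 0 ≤ ‖y‖ ^ m := by positivity
    nlinarith
  have h4 : ‖g x - g y‖ ≤ |K| * ‖x - y‖ := (hg x y).trans (by gcongr; exact le_abs_self K)
  calc C * (1 + ‖g x‖ ^ m + ‖g y‖ ^ m) * ‖g x - g y‖
      ≤ C * ((1 + 2 * A) * (1 + ‖x‖ ^ m + ‖y‖ ^ m)) * (|K| * ‖x - y‖) := by gcongr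
    _ = C * (1 + 2 * A) * |K| * (1 + ‖x‖ ^ m + ‖y‖ ^ m) * ‖x - y‖ := by ring

theorem IsLocLip.add {φ ψ : V → ℝ} (hφ : IsLocLip φ) (hψ : IsLocLip ψ) :
    IsLocLip (fun x => φ x + ψ x) := by
  obtain ⟨C, m, hC, h⟩ := hφ.exists_nonneg
  obtain ⟨D, n, hD, k⟩ := hψ.exists_nonneg
  refine ⟨3 * (C + D), m + n, fun x y => ?_⟩
  have key : ∀ j, j ≤ m + n →
      1 + ‖x‖ ^ j + ‖y‖ ^ j ≤ 3 * (1 + ‖x‖ ^ (m + n) + ‖y‖ ^ (m + n)) := by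
    intro j hj
    have h1 := pow_le_one_add_pow (norm_nonneg x) hj
    have h2 := pow_le_one_add_pow (norm_nonneg y) hj
    have : 0 ≤ ‖x‖ ^ (m + n) := by positivity
    have : 0 ≤ ‖y‖ ^ (m + n) := by positivity
    linarith
  calc |φ x + ψ x - (φ y + ψ y)| = |(φ x - φ y) + (ψ x - ψ y)| := by congr 1; ring
    _ ≤ |φ x - φ y| + |ψ x - ψ y| := abs_add_le _ _
    _ ≤ C * (1 + ‖x‖ ^ m + ‖y‖ ^ m) * ‖x - y‖ + D * (1 + ‖x‖ ^ n + ‖y‖ ^ n) * ‖x - y‖ :=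
        add_le_add (h x y) (k x y)
    _ ≤ C * (3 * (1 + ‖x‖ ^ (m + n) + ‖y‖ ^ (m + n))) * ‖x - y‖
        + D * (3 * (1 + ‖x‖ ^ (m + n) + ‖y‖ ^ (m + n))) * ‖x - y‖ := by
        gcongr C * ?_ * _ + D * ?_ * _
        · exact key m (by omega)
        · exact key n (by omega)
    _ = _ := by ring

theorem IsLocLip.const_mul {φ : V → ℝ} (hφ : IsLocLip φ) (c : ℝ) :
    IsLocLip (fun x => c * φ x) := by
  obtain ⟨C, m, h⟩ := hφ
  refine ⟨|c| * C, m, fun x y => ?_⟩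
  rw [← mul_sub, abs_mul]
  calc |c| * |φ x - φ y| ≤ |c| * (C * (1 + ‖x‖ ^ m + ‖y‖ ^ m) * ‖x - y‖) := by
        gcongr; exact h x y
    _ = _ := by ring

theorem isLocLip_const (c : ℝ) : IsLocLip (fun _ : V => c) :=
  .of_lipschitz 0 (by simp)

theorem isLocLip_id : IsLocLip (fun x : ℝ => x) :=
  .of_lipschitz 1 (by simp)

theorem isLocLip_pow (n : ℕ) : IsLocLip (fun x : ℝ => x ^ n) := by
  refine ⟨n, n - 1, fun x y => ?_⟩
  have h := abs_pow_sub_pow_le x y n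
  have h1 : max |x| |y| ^ (n - 1) ≤ 1 + ‖x‖ ^ (n - 1) + ‖y‖ ^ (n - 1) := by
    have h2 : 0 ≤ |x| ^ (n - 1) := by positivity
    have h3 : 0 ≤ |y| ^ (n - 1) := by positivity
    simp only [Real.norm_eq_abs]
    rcases max_choice |x| |y| with h | h <;> rw [h] <;> linarith
  calc |x ^ n - y ^ n| ≤ |x - y| * n * max |x| |y| ^ (n - 1) := h
    _ ≤ |x - y| * n * (1 + ‖x‖ ^ (n - 1) + ‖y‖ ^ (n - 1)) := by gcongr
    _ = _ := by rw [Real.norm_eq_abs (x - y)]; ring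

theorem isLocLip_abs_pow (n : ℕ) : IsLocLip (fun x : ℝ => |x| ^ n) :=
  (isLocLip_pow n).comp (fun x : ℝ => |x|) 1 fun x y => by
    simpa using abs_abs_sub_abs_le x y

theorem IsLocLip.comp_affine {φ : ℝ → ℝ} (hφ : IsLocLip φ) (x c : ℝ) :
    IsLocLip (fun y => φ (x + c * y)) :=
  hφ.comp (fun y => x + c * y) |c| fun y z => by
    rw [show x + c * y - (x + c * z) = c * (y - z) by ring, norm_mul, Real.norm_eq_abs c]

theorem IsLocLip.comp_affine₂ {φ : ℝ → ℝ} (hφ : IsLocLip φ) (x a b : ℝ) :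
    IsLocLip (fun p : ℝ × ℝ => φ (x + a * p.1 + b * p.2)) :=
  hφ.comp (fun p : ℝ × ℝ => x + a * p.1 + b * p.2) (|a| + |b|) fun p q => by
    rw [show x + a * p.1 + b * p.2 - (x + a * q.1 + b * q.2)
      = a * (p.1 - q.1) + b * (p.2 - q.2) by ring, add_mul]
    refine (norm_add_le _ _).trans (add_le_add ?_ ?_)
    · rw [norm_mul, Real.norm_eq_abs a]
      gcongr
      exact norm_fst_le (p - q)
    · rw [norm_mul, Real.norm_eq_abs b]
      gcongr
      exact norm_snd_le (p - q)

end LocLip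

/-! ### Elementary calculus of sublinear expectations -/

namespace SublinearSpace

variable {Ω : Type*} (S : SublinearSpace Ω)

theorem comp_mem_one {X : Ω → ℝ} (hX : X ∈ S.H) {φ : ℝ → ℝ} (hφ : IsLocLip φ) :
    (fun ω => φ (X ω)) ∈ S.H :=
  S.comp_mem 1 (fun _ => X) (fun _ => hX) (fun v => φ (v 0))
    (hφ.comp (fun v : Fin 1 → ℝ => v 0) 1 fun x y => by
      simpa using norm_le_pi_norm (x - y) 0)

theorem comp_mem_two {X Y : Ω → ℝ} (hX : X ∈ S.H) (hY : Y ∈ S.H) {φ : ℝ × ℝ → ℝ}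
    (hφ : IsLocLip φ) : (fun ω => φ (X ω, Y ω)) ∈ S.H :=
  S.comp_mem 2 ![X, Y] (fun i => by fin_cases i <;> assumption) (fun v => φ (v 0, v 1))
    (hφ.comp (fun v : Fin 2 → ℝ => (v 0, v 1)) 1 fun x y => by
      rw [one_mul, Prod.norm_def]
      exact max_le (norm_le_pi_norm (x - y) 0) (norm_le_pi_norm (x - y) 1))

theorem add_mem {X Y : Ω → ℝ} (hX : X ∈ S.H) (hY : Y ∈ S.H) :
    (fun ω => X ω + Y ω) ∈ S.H := S.H.add_mem hX hY

theorem const_mul_mem {X : Ω → ℝ} (hX : X ∈ S.H) (c : ℝ) :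
    (fun ω => c * X ω) ∈ S.H := S.H.smul_mem c hX

theorem E_add_const {X : Ω → ℝ} (hX : X ∈ S.H) (c : ℝ) :
    S.E (fun ω => X ω + c) = S.E X + c := by
  apply le_antisymm
  · simpa [S.const] using S.subadd X hX _ (S.const_mem c)
  · have := S.subadd _ (S.add_mem hX (S.const_mem c)) _ (S.const_mem (-c))
    simp only [add_neg_cancel_right, S.const] at this
    linarith

theorem E_const_mul {X : Ω → ℝ} (hX : X ∈ S.H) {c : ℝ} (hc : 0 ≤ c) :
    S.E (fun ω => c * X ω) = c * S.E X := by
  rcases hc.eq_or_lt with rfl | hc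
  · simpa using S.const 0
  · exact S.pos_homog X hX c hc

theorem E_le_add {X Y Z : Ω → ℝ} (hX : X ∈ S.H) (hY : Y ∈ S.H) (hZ : Z ∈ S.H)
    (h : ∀ ω, X ω ≤ Y ω + Z ω) : S.E X ≤ S.E Y + S.E Z :=
  (S.mono _ (S.add_mem hY hZ) _ hX h).trans (S.subadd Y hY Z hZ)

theorem E_le_add_const {X Y : Ω → ℝ} (hX : X ∈ S.H) (hY : Y ∈ S.H) {c : ℝ}
    (h : ∀ ω, X ω ≤ Y ω + c) : S.E X ≤ S.E Y + c := by
  simpa [S.const] using S.E_le_add hX hY (S.const_mem c) h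

theorem abs_E_sub_le {X Y Z : Ω → ℝ} (hX : X ∈ S.H) (hY : Y ∈ S.H) (hZ : Z ∈ S.H)
    (h : ∀ ω, |X ω - Y ω| ≤ Z ω) : |S.E X - S.E Y| ≤ S.E Z := by
  rw [abs_sub_le_iff]
  constructor
  · have := S.E_le_add hX hY hZ fun ω => by have := (abs_sub_le_iff.1 (h ω)).1; linarith
    linarith
  · have := S.E_le_add hY hX hZ fun ω => by have := (abs_sub_le_iff.1 (h ω)).2; linarith
    linarith

theorem E_sum_le {ι : Type*} (s : Finset ι) {X : ι → Ω → ℝ} (hX : ∀ i, X i ∈ S.H) :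
    (fun ω => ∑ i ∈ s, X i ω) ∈ S.H ∧
      S.E (fun ω => ∑ i ∈ s, X i ω) ≤ ∑ i ∈ s, S.E (X i) := by
  classical
  induction s using Finset.induction_on with
  | empty => simpa using ⟨S.const_mem 0, (S.const 0).le⟩
  | insert a s ha ih =>
    simp only [Finset.sum_insert ha]
    exact ⟨S.add_mem (hX a) ih.1, (S.subadd _ (hX a) _ ih.1).trans (by linarith [ih.2])⟩

/-- Random variables without mean uncertainty can be dropped from a sum. -/
theorem E_add_eq_of_centered {X Y : Ω → ℝ} (hX : X ∈ S.H) (hY : Y ∈ S.H)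
    (hc : ∀ c : ℝ, S.E (fun ω => c * X ω) = 0) (c : ℝ) :
    S.E (fun ω => c * X ω + Y ω) = S.E Y := by
  have hcX := S.const_mul_mem hX
  apply le_antisymm
  · have := S.subadd _ (hcX c) _ hY
    rwa [hc, zero_add] at this
  · have := S.E_le_add hY (hcX (-c)) (S.add_mem (hcX c) hY) fun ω => by linarith
    rwa [hc, zero_add] at this

/-- The function obtained by integrating out the second variable is a test function. -/
theorem isLocLip_E {Y : Ω → ℝ} (hY : Y ∈ S.H) {φ : ℝ × ℝ → ℝ} (hφ : IsLocLip φ) :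
    IsLocLip (fun x : ℝ => S.E (fun ω => φ (x, Y ω))) := by
  obtain ⟨C, m, hC, h⟩ := hφ.exists_nonneg
  have hmem : ∀ x : ℝ, (fun ω => φ (x, Y ω)) ∈ S.H := fun x =>
    S.comp_mem_two (S.const_mem x) hY hφ
  have hYm : (fun ω => |Y ω| ^ m) ∈ S.H := S.comp_mem_one hY (isLocLip_abs_pow m)
  set e := S.E (fun ω => |Y ω| ^ m) with he
  have he0 : 0 ≤ e := by
    have := S.mono _ hYm _ (S.const_mem 0) fun ω => by positivity
    rwa [S.const] at this
  refine ⟨C * (1 + 2 * e), m, fun x y => ?_⟩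
  have hprod : ∀ x z : ℝ, ‖(x, z)‖ ^ m ≤ |x| ^ m + |z| ^ m := by
    intro x z
    change max |x| |z| ^ m ≤ _
    have h2 : 0 ≤ |x| ^ m := by positivity
    have h3 : 0 ≤ |z| ^ m := by positivity
    rcases max_choice |x| |z| with h | h <;> rw [h] <;> linarith
  -- The dominating variable is a nonnegative multiple of |Y|^m plus a constant, so its expectation
  -- is computed exactly rather than merely bounded.
  have hb := S.abs_E_sub_le (hmem x) (hmem y)
    (Z := fun ω => (2 * C * |x - y|) * |Y ω| ^ m + C * (1 + |x| ^ m + |y| ^ m) * |x - y|)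
    (S.add_mem (S.const_mul_mem hYm _) (S.const_mem _)) fun ω => by
      refine (h _ _).trans ?_
      have h1 : ‖(x, Y ω) - (y, Y ω)‖ = |x - y| := by
        simp [Prod.norm_def]
      rw [h1]
      have h2 := hprod x (Y ω)
      have h3 := hprod y (Y ω)
      calc C * (1 + ‖(x, Y ω)‖ ^ m + ‖(y, Y ω)‖ ^ m) * |x - y|
          ≤ C * (1 + (|x| ^ m + |Y ω| ^ m) + (|y| ^ m + |Y ω| ^ m)) * |x - y| := by gcongr
        _ = _ := by ring
  rw [S.E_add_const (S.const_mul_mem hYm _), S.E_const_mul hYm (by positivity), ← he] at hb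
  refine hb.trans ?_
  simp only [Real.norm_eq_abs]
  have : 0 ≤ C * |x - y| * e * (|x| ^ m + |y| ^ m) := by positivity
  nlinarith

end SublinearSpace
-- Smoothing by box averages and Taylor expansion
/-- The average of `f` over `[x, x + ε]`. -/
noncomputable def boxAvg (ε : ℝ) (f : ℝ → ℝ) (x : ℝ) : ℝ := ε⁻¹ * ∫ y in x..(x + ε), f y

/-- `f` is Lipschitz with constant `L`. -/
def IsLip (L : ℝ) (f : ℝ → ℝ) : Prop := ∀ x y, |f x - f y| ≤ L * |x - y|

namespace IsLip

variable {L : ℝ} {f : ℝ → ℝ}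

theorem nonneg (hf : IsLip L f) : 0 ≤ L := by
  have := (abs_nonneg _).trans (hf 1 0)
  simpa using this

theorem isLocLip (hf : IsLip L f) : IsLocLip f := .of_lipschitz L hf

theorem continuous (hf : IsLip L f) : Continuous f :=
  (LipschitzWith.of_dist_le_mul (K := L.toNNReal) fun x y => by
    simpa [Real.dist_eq, Real.coe_toNNReal L hf.nonneg] using hf x y).continuous

end IsLip

theorem boxAvg_eq {ε : ℝ} (hε : 0 < ε) (f : ℝ → ℝ) (x : ℝ) :
    boxAvg ε f x = ∫ y in (0 : ℝ)..1, f (x + ε * y) := by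
  have := intervalIntegral.integral_comp_add_mul (a := 0) (b := 1) f hε.ne' x
  rw [this, boxAvg]
  simp

theorem boxAvg_mono {ε : ℝ} (hε : 0 < ε) {f g : ℝ → ℝ} (hf : Continuous f) (hg : Continuous g)
    (h : ∀ x, f x ≤ g x) (x : ℝ) : boxAvg ε f x ≤ boxAvg ε g x := by
  rw [boxAvg_eq hε, boxAvg_eq hε]
  apply intervalIntegral.integral_mono_on zero_le_one
  · apply Continuous.intervalIntegrable; fun_prop
  · apply Continuous.intervalIntegrable; fun_prop
  · exact fun y _ => h _

theorem IsLip.boxAvg {ε : ℝ} (hε : 0 < ε) {L : ℝ} {f : ℝ → ℝ} (hf : IsLip L f) :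
    IsLip L (boxAvg ε f) := by
  intro x y
  have hc := hf.continuous
  rw [boxAvg_eq hε, boxAvg_eq hε, ← intervalIntegral.integral_sub
    (by apply Continuous.intervalIntegrable; fun_prop)
    (by apply Continuous.intervalIntegrable; fun_prop)]
  have := intervalIntegral.norm_integral_le_of_norm_le_const (a := 0) (b := 1)
    (f := fun z => f (x + ε * z) - f (y + ε * z)) (C := L * |x - y|) fun z _ => by
      simpa using hf (x + ε * z) (y + ε * z)
  simpa using this

theorem IsLip.abs_boxAvg_sub_le {ε : ℝ} (hε : 0 < ε) {L : ℝ} {f : ℝ → ℝ} (hf : IsLip L f)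
    (x : ℝ) : |SublinearExp.boxAvg ε f x - f x| ≤ L * ε := by
  have hc := hf.continuous
  have h1 : SublinearExp.boxAvg ε f x - f x = ∫ y in (0 : ℝ)..1, (f (x + ε * y) - f x) := by
    rw [boxAvg_eq hε, intervalIntegral.integral_sub
      (by apply Continuous.intervalIntegrable; fun_prop) (by simp)]
    simp
  rw [h1]
  have := intervalIntegral.norm_integral_le_of_norm_le_const (a := 0) (b := 1)
    (f := fun z => f (x + ε * z) - f x) (C := L * ε) fun z hz => by
      rw [Set.uIoc_of_le zero_le_one] at hz
      refine (hf _ _).trans ?_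
      have hL := hf.nonneg
      rw [add_sub_cancel_left, abs_of_nonneg (mul_nonneg hε.le hz.1.le)]
      have := mul_le_mul_of_nonneg_left hz.2 hε.le
      nlinarith
  simpa using this

/-- Riemann sums approximate the box average uniformly. -/
theorem IsLip.abs_boxAvg_sub_sum_le {ε : ℝ} (hε : 0 < ε) {L : ℝ} {f : ℝ → ℝ} (hf : IsLip L f)
    {N : ℕ} (hN : 0 < N) (x : ℝ) :
    |SublinearExp.boxAvg ε f x - ∑ i ∈ Finset.range N, (N : ℝ)⁻¹ * f (x + ε * (i / N))|
      ≤ L * ε / N := by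
  have hc := hf.continuous
  have hN' : (0 : ℝ) < N := by exact_mod_cast hN
  have h1 : SublinearExp.boxAvg ε f x
      = ∑ i ∈ Finset.range N, ∫ y in ((i : ℝ) / N)..((i + 1 : ℕ) : ℝ) / N, f (x + ε * y) := by
    rw [boxAvg_eq hε, intervalIntegral.sum_integral_adjacent_intervals
      (a := fun i : ℕ => (i : ℝ) / N)]
    · simp [hN'.ne']
    · intro k _
      apply Continuous.intervalIntegrable; fun_prop
  rw [h1, ← Finset.sum_sub_distrib]
  have h2 : ∀ i ∈ Finset.range N, |(∫ y in ((i : ℝ) / N)..((i + 1 : ℕ) : ℝ) / N, f (x + ε * y))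
      - (N : ℝ)⁻¹ * f (x + ε * (i / N))| ≤ L * ε / N * (N : ℝ)⁻¹ := by
    intro i _
    have hlen : ((i + 1 : ℕ) : ℝ) / N - (i : ℝ) / N = (N : ℝ)⁻¹ := by
      push_cast; field_simp; ring
    have hle : (i : ℝ) / N ≤ ((i + 1 : ℕ) : ℝ) / N := by
      have : 0 < (N : ℝ)⁻¹ := by positivity
      linarith
    have h3 : (∫ y in ((i : ℝ) / N)..((i + 1 : ℕ) : ℝ) / N, f (x + ε * y))
        - (N : ℝ)⁻¹ * f (x + ε * (i / N))
        = ∫ y in ((i : ℝ) / N)..((i + 1 : ℕ) : ℝ) / N, (f (x + ε * y) - f (x + ε * (i / N))) := by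
      rw [intervalIntegral.integral_sub
        (by apply Continuous.intervalIntegrable; fun_prop) (by simp),
        intervalIntegral.integral_const, hlen, smul_eq_mul]
    rw [h3]
    have := intervalIntegral.norm_integral_le_of_norm_le_const
      (a := (i : ℝ) / N) (b := ((i + 1 : ℕ) : ℝ) / N)
      (f := fun y => f (x + ε * y) - f (x + ε * (i / N))) (C := L * ε / N) fun z hz => by
        rw [Set.uIoc_of_le hle] at hz
        refine (hf _ _).trans ?_
        have hL := hf.nonneg
        have hz1 : 0 ≤ z - i / N := by linarith [hz.1]
        have hz2 : z - i / N ≤ (N : ℝ)⁻¹ := by linarith [hz.2]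
        rw [show x + ε * z - (x + ε * (i / N)) = ε * (z - i / N) by ring,
          abs_of_nonneg (mul_nonneg hε.le hz1), div_eq_mul_inv (L * ε), mul_assoc L]
        gcongr
    rwa [hlen, Real.norm_eq_abs, abs_of_pos (inv_pos.2 hN')] at this
  refine (Finset.abs_sum_le_sum_abs _ _).trans ((Finset.sum_le_sum h2).trans (le_of_eq ?_))
  rw [Finset.sum_const, Finset.card_range, nsmul_eq_mul]
  field_simp

/-- Each average gains one derivative, so two averages of a Lipschitz function have a Lipschitz
second derivative. -/
theorem hasDerivAt_boxAvg (ε : ℝ) {f : ℝ → ℝ} (hf : Continuous f) (x : ℝ) :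
    HasDerivAt (boxAvg ε f) (ε⁻¹ * (f (x + ε) - f x)) x := by
  have h0 : ∀ z, HasDerivAt (fun u => ∫ y in (0 : ℝ)..u, f y) (f z) z := fun z =>
    intervalIntegral.integral_hasDerivAt_right (hf.intervalIntegrable _ _)
      (hf.stronglyMeasurableAtFilter _ _) hf.continuousAt
  have h1 : HasDerivAt (fun u => ∫ y in (0 : ℝ)..(u + ε), f y) (f (x + ε)) x :=
    (h0 (x + ε)).comp_add_const x ε
  have h2 := (h1.sub (h0 x)).const_mul ε⁻¹
  refine h2.congr_of_eventuallyEq (Filter.Eventually.of_forall fun u => ?_)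
  simp only [boxAvg, Pi.sub_apply]
  rw [intervalIntegral.integral_interval_sub_left (hf.intervalIntegrable _ _)
    (hf.intervalIntegrable _ _)]

theorem abs_le_of_hasDerivAt {g g' : ℝ → ℝ} (hg : ∀ y, HasDerivAt g (g' y) y) (h0 : g 0 = 0)
    {y C : ℝ} (hC : ∀ z, |z| ≤ |y| → |g' z| ≤ C) : |g y| ≤ C * |y| := by
  have := (convex_Icc (-|y|) |y|).norm_image_sub_le_of_norm_hasDerivWithin_le (f := g) (f' := g')
    (C := C) (x := 0) (y := y) (fun z _ => (hg z).hasDerivWithinAt)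
    (fun z hz => hC z (abs_le.2 hz)) ⟨by simp, by simp⟩ ⟨neg_abs_le y, le_abs_self y⟩
  simpa [h0] using this

/-- Second order Taylor expansion with a Lipschitz second derivative. -/
theorem abs_taylor_two_le {w w' w'' : ℝ → ℝ} {K : ℝ} (h1 : ∀ x, HasDerivAt w (w' x) x)
    (h2 : ∀ x, HasDerivAt w' (w'' x) x) (h3 : IsLip K w'') (x y : ℝ) :
    |w (x + y) - (w x + w' x * y + w'' x / 2 * y ^ 2)| ≤ K * |y| ^ 3 := by
  have hK := h3.nonneg
  have key : ∀ z, |w' (x + z) - w' x - w'' x * z| ≤ K * |z| ^ 2 := by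
    intro z
    have hd : ∀ u, HasDerivAt (fun u => w' (x + u) - w' x - w'' x * u)
        (w'' (x + u) - w'' x) u := fun u => by
      have := (((h2 (x + u)).comp_const_add x u).sub_const (w' x)).sub
        ((hasDerivAt_id u).const_mul (w'' x))
      exact this.congr_deriv (by simp)
    have := abs_le_of_hasDerivAt hd (by simp) (y := z) (C := K * |z|) fun u hu => by
      refine (h3 _ _).trans ?_
      rw [add_sub_cancel_left]
      gcongr
    calc _ ≤ K * |z| * |z| := this
      _ = _ := by ring
  have hd : ∀ u, HasDerivAt (fun u => w (x + u) - (w x + w' x * u + w'' x / 2 * u ^ 2))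
      (w' (x + u) - w' x - w'' x * u) u := fun u => by
    have := ((h1 (x + u)).comp_const_add x u).sub
      ((((hasDerivAt_id u).const_mul (w' x)).const_add (w x)).add
        ((hasDerivAt_pow 2 u).const_mul (w'' x / 2)))
    refine this.congr_deriv ?_
    simp
    ring
  have := abs_le_of_hasDerivAt hd (by simp) (y := y) (C := K * |y| ^ 2) fun u hu => by
    refine (key u).trans ?_
    gcongr
  calc _ ≤ K * |y| ^ 2 * |y| := this
    _ = _ := by ring

/-- The second derivative of the iterated box average. -/
noncomputable def boxAvgDeriv₂ (ε : ℝ) (f : ℝ → ℝ) (x : ℝ) : ℝ :=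
  ε⁻¹ * (ε⁻¹ * (f (x + ε + ε) - f (x + ε)) - ε⁻¹ * (f (x + ε) - f x))

/-- A second difference has weights 1, -2, 1, whose absolute values sum to 4. -/
theorem IsLip.boxAvgDeriv₂ {ε : ℝ} (hε : 0 < ε) {L : ℝ} {f : ℝ → ℝ} (hf : IsLip L f) :
    IsLip (4 * L * (ε⁻¹ * ε⁻¹)) (boxAvgDeriv₂ ε f) := by
  intro x y
  have h0 := hf x y
  have h1 := hf (x + ε) (y + ε)
  have h2 := hf (x + ε + ε) (y + ε + ε)
  simp only [add_sub_add_right_eq_sub] at h1 h2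
  have : SublinearExp.boxAvgDeriv₂ ε f x - SublinearExp.boxAvgDeriv₂ ε f y
      = (ε⁻¹ * ε⁻¹) * ((f (x + ε + ε) - f (y + ε + ε)) - 2 * (f (x + ε) - f (y + ε))
        + (f x - f y)) := by
    simp only [SublinearExp.boxAvgDeriv₂]; ring
  rw [this, abs_mul, abs_of_nonneg (by positivity : 0 ≤ ε⁻¹ * ε⁻¹)]
  have h3 : |(f (x + ε + ε) - f (y + ε + ε)) - 2 * (f (x + ε) - f (y + ε)) + (f x - f y)|
      ≤ 4 * L * |x - y| := by
    rw [abs_le] at *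
    constructor <;> linarith
  calc _ ≤ (ε⁻¹ * ε⁻¹) * (4 * L * |x - y|) := by gcongr
    _ = _ := by ring

/-- The linear coefficient is left unspecified because centered variables do not see it. -/
theorem IsLip.abs_taylor_boxAvg_le {ε : ℝ} (hε : 0 < ε) {L : ℝ} {f : ℝ → ℝ} (hf : IsLip L f)
    (x : ℝ) : ∃ c : ℝ, ∀ y : ℝ,
    |SublinearExp.boxAvg ε (SublinearExp.boxAvg ε f) (x + y)
      - (SublinearExp.boxAvg ε (SublinearExp.boxAvg ε f) x + c * y
        + SublinearExp.boxAvgDeriv₂ ε f x / 2 * y ^ 2)| ≤ 4 * L * (ε⁻¹ * ε⁻¹) * |y| ^ 3 :=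
  ⟨_, abs_taylor_two_le (hasDerivAt_boxAvg ε (hf.boxAvg hε).continuous)
    (fun x => (((hasDerivAt_boxAvg ε hf.continuous (x + ε)).comp_add_const x ε).sub
      (hasDerivAt_boxAvg ε hf.continuous x)).const_mul ε⁻¹) (hf.boxAvgDeriv₂ hε) x⟩

theorem le_of_forall_le_add_div {a b c : ℝ} (h : ∀ N : ℕ, 0 < N → a ≤ b + c / N) : a ≤ b := by
  have h1 : Filter.Tendsto (fun N : ℕ => b + c / N) Filter.atTop (nhds (b + 0)) :=
    (tendsto_const_div_atTop_nhds_zero_nat c).const_add b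
  rw [add_zero] at h1
  exact ge_of_tendsto h1 ((Filter.eventually_gt_atTop 0).mono h)

theorem IsIndepOf.E_comp_affine {Ω : Type*} {S : SublinearSpace Ω} {X Y : Ω → ℝ}
    (h : IsIndepOf S Y X) {f : ℝ → ℝ} (hf : IsLocLip f) (x a b : ℝ) :
    S.E (fun ω => f (x + a * X ω + b * Y ω))
      = S.E (fun ω => S.E (fun ω' => f (x + a * X ω + b * Y ω'))) :=
  h _ (hf.comp_affine₂ x a b)

/-! ### The operators f ↦ 𝔼[f(x + √t X)] -/

namespace SublinearSpace

variable {Ω : Type*} (S : SublinearSpace Ω) {X : Ω → ℝ} {f g : ℝ → ℝ} {L : ℝ}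

/-- The family of operators `f ↦ 𝔼[f(x + √t X)]`, a semigroup when `X` is G-normal. -/
noncomputable def heat (X : Ω → ℝ) (t : ℝ) (f : ℝ → ℝ) (x : ℝ) : ℝ :=
  S.E (fun ω => f (x + √t * X ω))

variable {S}

theorem affine_mem (hX : X ∈ S.H) (hf : IsLocLip f) (x c : ℝ) :
    (fun ω => f (x + c * X ω)) ∈ S.H :=
  S.comp_mem_one hX (hf.comp_affine x c)

theorem isLocLip_E_affine (hX : X ∈ S.H) (hf : IsLocLip f) (c : ℝ) :
    IsLocLip (fun x => S.E (fun ω => f (x + c * X ω))) := by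
  have := S.isLocLip_E hX (hf.comp_affine₂ 0 1 c)
  simpa using this

theorem isLocLip_heat (hX : X ∈ S.H) (hf : IsLocLip f) (t : ℝ) : IsLocLip (S.heat X t f) :=
  isLocLip_E_affine hX hf _

theorem heat_zero (f : ℝ → ℝ) (x : ℝ) : S.heat X 0 f x = f x := by
  simp [heat, S.const]

theorem heat_le_add_const (hX : X ∈ S.H) (hf : IsLocLip f) (hg : IsLocLip g) {c : ℝ}
    (h : ∀ x, f x ≤ g x + c) (t x : ℝ) : S.heat X t f x ≤ S.heat X t g x + c :=
  S.E_le_add_const (affine_mem hX hf _ _) (affine_mem hX hg _ _) fun _ => h _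

theorem isLip_heat (hX : X ∈ S.H) (hf : IsLip L f) (t : ℝ) : IsLip L (S.heat X t f) := by
  intro x y
  have := S.abs_E_sub_le (affine_mem hX hf.isLocLip x √t) (affine_mem hX hf.isLocLip y √t)
    (S.const_mem (L * |x - y|)) fun ω => by simpa using hf (x + √t * X ω) (y + √t * X ω)
  rwa [S.const] at this

/-- Sub-additivity extended from finite sums to integrals: Riemann sums of Lipschitz functions
converge uniformly, so no continuity of the expectation is needed. -/
theorem heat_boxAvg_le (hX : X ∈ S.H) (hf : IsLip L f) {ε : ℝ} (hε : 0 < ε) (t x : ℝ) :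
    S.heat X t (boxAvg ε f) x ≤ boxAvg ε (S.heat X t f) x := by
  refine le_of_forall_le_add_div (c := 2 * (L * ε)) fun N hN => ?_
  have hm : ∀ i : ℕ, (fun ω => f (x + ε * (i / N) + √t * X ω)) ∈ S.H := fun i =>
    affine_mem hX hf.isLocLip _ _
  have h1 := S.E_sum_le (Finset.range N) fun i => S.const_mul_mem (hm i) (N : ℝ)⁻¹
  have h2 := S.E_le_add_const (affine_mem hX (hf.boxAvg hε).isLocLip x √t) h1.1
    (c := L * ε / N) fun ω => by
      have := (abs_sub_le_iff.1 (hf.abs_boxAvg_sub_sum_le hε hN (x + √t * X ω))).1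
      simp only [add_right_comm x _ (√t * X ω)]
      linarith
  have h3 := (abs_sub_le_iff.1 ((isLip_heat hX hf t).abs_boxAvg_sub_sum_le hε hN x)).2
  have h4 : ∑ i ∈ Finset.range N, S.E (fun ω => (N : ℝ)⁻¹ * f (x + ε * (i / N) + √t * X ω))
      = ∑ i ∈ Finset.range N, (N : ℝ)⁻¹ * S.heat X t f (x + ε * (i / N)) :=
    Finset.sum_congr rfl fun i _ => S.E_const_mul (hm i) (by positivity)
  have h5 := h1.2
  rw [h4] at h5
  change S.heat X t (boxAvg ε f) x ≤ _ at h2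
  have h6 : 2 * (L * ε) / N = L * ε / N + L * ε / N := by ring
  linarith

theorem heat_boxAvg_boxAvg_le (hX : X ∈ S.H) (hf : IsLip L f) {ε : ℝ} (hε : 0 < ε) (t x : ℝ) :
    S.heat X t (boxAvg ε (boxAvg ε f)) x ≤ boxAvg ε (boxAvg ε (S.heat X t f)) x :=
  (heat_boxAvg_le hX (hf.boxAvg hε) hε t x).trans <|
    boxAvg_mono hε (isLip_heat hX (hf.boxAvg hε) t).continuous
      ((isLip_heat hX hf t).boxAvg hε).continuous (heat_boxAvg_le hX hf hε t) x

/-- With increment √t X the linear term drops out, the quadratic one is of order t, and the cubic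
remainder is of order t√t. -/
theorem abs_heat_sub_le (hX : X ∈ S.H) (hc : ∀ c : ℝ, S.E (fun ω => c * X ω) = 0)
    {w : ℝ → ℝ} (hw : IsLocLip w) {x c d K : ℝ}
    (h : ∀ y, |w (x + y) - (w x + c * y + d / 2 * y ^ 2)| ≤ K * |y| ^ 3) (hK : 0 ≤ K)
    {t : ℝ} (ht : 0 ≤ t) :
    |S.heat X t w x - (w x + S.E (fun ω => d / 2 * t * X ω ^ 2))|
      ≤ K * S.E (fun ω => |X ω| ^ 3) * (t * √t) := by
  have hsq : (fun ω => X ω ^ 2) ∈ S.H := S.comp_mem_one hX (isLocLip_pow 2)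
  have hcu : (fun ω => |X ω| ^ 3) ∈ S.H := S.comp_mem_one hX (isLocLip_abs_pow 3)
  have hq := S.const_mul_mem hsq (d / 2 * t)
  have hY : (fun ω => d / 2 * t * X ω ^ 2 + w x) ∈ S.H := S.add_mem hq (S.const_mem _)
  have h1 := S.abs_E_sub_le (affine_mem hX hw x √t)
    (S.add_mem (S.const_mul_mem hX (c * √t)) hY) (S.const_mul_mem hcu (K * (t * √t)))
    fun ω => by
      have := h (√t * X ω)
      have hs := Real.sq_sqrt ht
      rw [abs_mul, abs_of_nonneg (Real.sqrt_nonneg t), mul_pow, mul_pow, hs,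
        show √t ^ 3 = t * √t by rw [pow_succ, hs]] at this
      calc _ = _ := by congr 1; ring
        _ ≤ _ := this
        _ = _ := by ring
  rw [S.E_add_eq_of_centered hX hY hc, S.E_add_const hq, S.E_const_mul hcu (by positivity)] at h1
  rw [add_comm (w x)]
  calc _ ≤ _ := h1
    _ = _ := by ring

end SublinearSpace

open SublinearSpace

/-! ### Semigroup property and centering of G-normal variables -/

section GNormal

variable {Ω : Type*} {S : SublinearSpace Ω} {X : Ω → ℝ} {f : ℝ → ℝ} {L : ℝ}

theorem IsGNormal.heat_add (hX : IsGNormal S X) (hf : IsLocLip f) {s t : ℝ} (hs : 0 ≤ s)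
    (ht : 0 ≤ t) (x : ℝ) : S.heat X (s + t) f x = S.heat X s (S.heat X t f) x := by
  obtain ⟨hXm, Ω', S', Y, Y', hY, hY', hYX, ⟨hind, hY'Y⟩, hstab⟩ := hX
  have h1 := hstab √s √t (Real.sqrt_nonneg s) (Real.sqrt_nonneg t) _ (hf.comp_affine x 1)
  rw [Real.sq_sqrt hs, Real.sq_sqrt ht] at h1
  simp only [one_mul, ← add_assoc] at h1
  rw [heat, ← h1, hind.E_comp_affine hf]
  have h2 : ∀ z, S'.E (fun ω => f (z + √t * Y' ω)) = S.heat X t f z := fun z =>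
    (hY'Y _ (hf.comp_affine z √t)).trans (hYX _ (hf.comp_affine z √t))
  simp only [h2]
  exact hYX _ ((isLocLip_heat hXm hf t).comp_affine x √s)

/-- Evaluate the semigroup law on the linear function cx at time 2: with e = 𝔼[cX], one side is √2 e
and the other 2e. -/
theorem IsGNormal.centered (hX : IsGNormal S X) (c : ℝ) : S.E (fun ω => c * X ω) = 0 := by
  have h1 := hX.heat_add (isLocLip_id.const_mul c) zero_le_one zero_le_one 0
  have hm := S.const_mul_mem hX.1 c
  have h2 : ∀ t x, S.heat X t (fun y => c * y) x = √t * S.E (fun ω => c * X ω) + c * x := by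
    intro t x
    rw [heat, ← S.E_const_mul hm (Real.sqrt_nonneg t),
      ← S.E_add_const (S.const_mul_mem hm _)]
    congr 1
    ext ω
    ring
  have h3 : S.heat X 1 (S.heat X 1 (fun y => c * y)) 0 = 2 * S.E (fun ω => c * X ω) := by
    have : S.heat X 1 (fun y => c * y) = fun x => c * x + S.E (fun ω => c * X ω) := by
      ext x; rw [h2]; simp [add_comm]
    rw [this, heat]
    simp only [zero_add, Real.sqrt_one, one_mul]
    rw [S.E_add_const hm]
    ring
  rw [h3, h2] at h1
  norm_num at h1
  exact h1

end GNormal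

/-! ### Uniqueness of the G-normal law with given variances -/

section Uniqueness

variable {Ω₁ Ω₂ : Type*} {S₁ : SublinearSpace Ω₁} {S₂ : SublinearSpace Ω₂}
  {X : Ω₁ → ℝ} {Y : Ω₂ → ℝ} {f : ℝ → ℝ} {L : ℝ}

/-- One step comparison of the two semigroups on regularised functions. -/
theorem heat_boxAvg_le_heat_boxAvg_add (hX : IsGNormal S₁ X) (hY : IsGNormal S₂ Y)
    (hXY : ∀ a : ℝ, S₁.E (fun ω => a * X ω ^ 2) = S₂.E (fun ω => a * Y ω ^ 2))
    (hf : IsLip L f) {ε : ℝ} (hε : 0 < ε) {t : ℝ} (ht : 0 ≤ t) (x : ℝ) :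
    S₂.heat Y t (boxAvg ε (boxAvg ε f)) x ≤ S₁.heat X t (boxAvg ε (boxAvg ε f)) x
      + 4 * L * (ε⁻¹ * ε⁻¹) * (S₁.E (fun ω => |X ω| ^ 3) + S₂.E (fun ω => |Y ω| ^ 3))
        * (t * √t) := by
  obtain ⟨c, hc⟩ := hf.abs_taylor_boxAvg_le hε x
  have hw := ((hf.boxAvg hε).boxAvg hε).isLocLip
  have hK : 0 ≤ 4 * L * (ε⁻¹ * ε⁻¹) := by
    have := hf.nonneg
    positivity
  have h1 := (abs_sub_le_iff.1 (abs_heat_sub_le hX.1 hX.centered hw hc hK ht)).2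
  have h2 := (abs_sub_le_iff.1 (abs_heat_sub_le hY.1 hY.centered hw hc hK ht)).1
  rw [hXY] at h1
  linarith

/-- At every step the averages are pulled back outside. The function being averaged is then the
`X`-evolution of `f`, still `L`-Lipschitz, so the one-step error is the same each time and errors
only add. -/
theorem heat_nsmul_boxAvg_le (hX : IsGNormal S₁ X) (hY : IsGNormal S₂ Y)
    (hXY : ∀ a : ℝ, S₁.E (fun ω => a * X ω ^ 2) = S₂.E (fun ω => a * Y ω ^ 2))
    (hf : IsLip L f) {ε : ℝ} (hε : 0 < ε) {t : ℝ} (ht : 0 ≤ t) (k : ℕ) (x : ℝ) :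
    S₂.heat Y (k * t) (boxAvg ε (boxAvg ε f)) x
      ≤ boxAvg ε (boxAvg ε (S₁.heat X (k * t) f)) x
      + k * (4 * L * (ε⁻¹ * ε⁻¹) * (S₁.E (fun ω => |X ω| ^ 3) + S₂.E (fun ω => |Y ω| ^ 3))
        * (t * √t)) := by
  set D := 4 * L * (ε⁻¹ * ε⁻¹) * (S₁.E (fun ω => |X ω| ^ 3) + S₂.E (fun ω => |Y ω| ^ 3))
    * (t * √t) with hD
  have hw := ((hf.boxAvg hε).boxAvg hε).isLocLip
  induction k generalizing x with
  | zero =>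
    have : S₁.heat X 0 f = f := funext fun x => heat_zero f x
    simp [heat_zero, this]
  | succ k ih =>
    have hkt : (0 : ℝ) ≤ k * t := by positivity
    have hu := isLip_heat hX.1 hf (k * t)
    have e : ((k + 1 : ℕ) : ℝ) * t = t + k * t := by push_cast; ring
    have e1 : S₁.heat X (t + k * t) f = S₁.heat X t (S₁.heat X (k * t) f) :=
      funext fun x => hX.heat_add hf.isLocLip ht hkt x
    rw [e, hY.heat_add hw ht hkt, e1]
    have h1 := heat_le_add_const hY.1 (isLocLip_heat hY.1 hw (k * t))
      ((hu.boxAvg hε).boxAvg hε).isLocLip ih t x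
    have h2 := heat_boxAvg_le_heat_boxAvg_add hX hY hXY hu hε ht x
    have h3 := heat_boxAvg_boxAvg_le hX.1 hu hε t x
    rw [← hD] at h2
    push_cast
    linarith

theorem heat_one_boxAvg_le (hX : IsGNormal S₁ X) (hY : IsGNormal S₂ Y)
    (hXY : ∀ a : ℝ, S₁.E (fun ω => a * X ω ^ 2) = S₂.E (fun ω => a * Y ω ^ 2))
    (hf : IsLip L f) {ε : ℝ} (hε : 0 < ε) (x : ℝ) :
    S₂.heat Y 1 (boxAvg ε (boxAvg ε f)) x ≤ boxAvg ε (boxAvg ε (S₁.heat X 1 f)) x := by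
  refine le_of_forall_le_add_div (c := 4 * L * (ε⁻¹ * ε⁻¹)
    * (S₁.E (fun ω => |X ω| ^ 3) + S₂.E (fun ω => |Y ω| ^ 3))) fun N hN => ?_
  have hN' : (N : ℝ) ≠ 0 := by exact_mod_cast hN.ne'
  -- N² steps of length N⁻² reach time 1, each costing a multiple of N⁻³.
  have h := heat_nsmul_boxAvg_le hX hY hXY hf hε (sq_nonneg (N : ℝ)⁻¹) (N ^ 2) x
  have e : ((N ^ 2 : ℕ) : ℝ) * (N : ℝ)⁻¹ ^ 2 = 1 := by push_cast; field_simp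
  rw [e, Real.sqrt_sq (by positivity), mul_left_comm, ← mul_assoc ((N ^ 2 : ℕ) : ℝ), e,
    one_mul, ← div_eq_mul_inv] at h
  exact h

theorem heat_one_le (hX : IsGNormal S₁ X) (hY : IsGNormal S₂ Y)
    (hXY : ∀ a : ℝ, S₁.E (fun ω => a * X ω ^ 2) = S₂.E (fun ω => a * Y ω ^ 2))
    (hf : IsLip L f) (x : ℝ) : S₂.heat Y 1 f x ≤ S₁.heat X 1 f x := by
  -- Take ε = 1/N: a double average moves an `L`-Lipschitz function by at most 2Lε, and this is paid
  -- once on each side.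
  refine le_of_forall_le_add_div (c := 4 * L) fun N hN => ?_
  have hε : (0 : ℝ) < (N : ℝ)⁻¹ := by positivity
  set ε := (N : ℝ)⁻¹ with hεdef
  have hB : ∀ {g : ℝ → ℝ}, IsLip L g → ∀ y, |boxAvg ε (boxAvg ε g) y - g y| ≤ 2 * L * ε := by
    intro g hg y
    have h1 := (hg.boxAvg hε).abs_boxAvg_sub_le hε y
    have h2 := hg.abs_boxAvg_sub_le hε y
    have := abs_sub_le (boxAvg ε (boxAvg ε g) y) (boxAvg ε g y) (g y)
    linarith
  have h1 := heat_le_add_const hY.1 hf.isLocLip ((hf.boxAvg hε).boxAvg hε).isLocLip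
    (c := 2 * L * ε) (fun y => by have := (abs_sub_le_iff.1 (hB hf y)).2; linarith) 1 x
  have h2 := heat_one_boxAvg_le hX hY hXY hf hε x
  have h3 := (abs_sub_le_iff.1 (hB (isLip_heat hX.1 hf 1) x)).1
  rw [div_eq_mul_inv, ← hεdef]
  linarith

/-- Test functions are approximated by Lipschitz functions with an error controlled by a single
test function. -/
theorem IsLocLip.exists_approx (hf : IsLocLip f) : ∃ ψ : ℝ → ℝ, IsLocLip ψ ∧
    ∀ N : ℕ, 0 < N → ∃ (L : ℝ) (g : ℝ → ℝ), IsLip L g ∧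
      ∀ x, |f x - g x| ≤ (N : ℝ)⁻¹ * ψ x := by
  obtain ⟨C, m, hC, h⟩ := hf.exists_nonneg
  simp only [Real.norm_eq_abs] at h
  refine ⟨fun x => C * (|x| ^ 2 + 2 * |x| ^ (m + 2)),
    ((isLocLip_abs_pow 2).add ((isLocLip_abs_pow (m + 2)).const_mul 2)).const_mul C,
    fun N hN => ?_⟩
  have hN' : (0 : ℝ) < N := by exact_mod_cast hN
  -- The approximant is f ∘ p, with p the truncation to [-N, N]. Where p moves x one has N ≤ |x|,
  -- hence N|x - p x| ≤ |x|², which supplies the factor 1/N.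
  set p : ℝ → ℝ := fun x => max (-N) (min N x) with hp
  have hpN : ∀ x, |p x| ≤ N := fun x =>
    abs_le.2 ⟨le_max_left _ _, max_le (by linarith) (min_le_left _ _)⟩
  have hplip : ∀ x y, |p x - p y| ≤ |x - y| := fun x y => by
    refine (abs_max_sub_max_le_max _ _ _ _).trans ?_
    rw [sub_self, abs_zero, max_eq_right (abs_nonneg _)]
    refine (abs_min_sub_min_le_max _ _ _ _).trans ?_
    rw [sub_self, abs_zero, max_eq_right (abs_nonneg _)]
  have hperr : ∀ x, |p x| ≤ |x| ∧ N * |x - p x| ≤ |x| ^ 2 := by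
    intro x
    rcases le_total |x| N with hx | hx
    · have : p x = x := by
        rw [abs_le] at hx
        simp only [hp]
        rw [min_eq_right hx.2, max_eq_right hx.1]
      rw [this]
      simpa using sq_nonneg x
    · have h1 : |p x| ≤ |x| := (hpN x).trans hx
      refine ⟨h1, ?_⟩
      have h2 : |x - p x| ≤ |x| := by
        rcases le_total 0 x with h0 | h0
        · rw [abs_of_nonneg h0] at hx
          have : p x = N := by
            simp only [hp]
            rw [min_eq_left hx, max_eq_right (by linarith)]
          rw [this, abs_of_nonneg h0, abs_of_nonneg (by linarith)]
          linarith
        · rw [abs_of_nonpos h0] at hx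
          have : p x = -N := by
            simp only [hp]
            rw [min_eq_right (by linarith), max_eq_left (by linarith)]
          rw [this, abs_of_nonpos h0, abs_of_nonpos (by linarith)]
          linarith
      rw [sq]
      gcongr
  refine ⟨C * (1 + N ^ m + N ^ m), fun x => f (p x), fun x y => ?_, fun x => ?_⟩
  · refine (h _ _).trans ?_
    gcongr C * (1 + ?_ ^ m + ?_ ^ m) * ?_
    exacts [hpN x, hpN y, hplip x y]
  · obtain ⟨h1, h2⟩ := hperr x
    rw [inv_mul_eq_div, le_div_iff₀ hN']
    calc |f x - f (p x)| * N ≤ C * (1 + |x| ^ m + |p x| ^ m) * |x - p x| * N := by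
          gcongr; exact h x (p x)
      _ ≤ C * (1 + |x| ^ m + |x| ^ m) * |x - p x| * N := by gcongr
      _ = C * (1 + |x| ^ m + |x| ^ m) * (N * |x - p x|) := by ring
      _ ≤ C * (1 + |x| ^ m + |x| ^ m) * |x| ^ 2 := by gcongr
      _ = _ := by ring

theorem E_comp_le_of_forall_isLip (hX : X ∈ S₁.H) (hY : Y ∈ S₂.H)
    (h : ∀ (L : ℝ) (g : ℝ → ℝ), IsLip L g →
      S₂.E (fun ω => g (Y ω)) ≤ S₁.E (fun ω => g (X ω))) (hf : IsLocLip f) :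
    S₂.E (fun ω => f (Y ω)) ≤ S₁.E (fun ω => f (X ω)) := by
  obtain ⟨ψ, hψ, happ⟩ := hf.exists_approx
  refine le_of_forall_le_add_div
    (c := S₁.E (fun ω => ψ (X ω)) + S₂.E (fun ω => ψ (Y ω))) fun N hN => ?_
  obtain ⟨L, g, hg, hfg⟩ := happ N hN
  have h1 := S₁.abs_E_sub_le (S₁.comp_mem_one hX hf) (S₁.comp_mem_one hX hg.isLocLip)
    (S₁.const_mul_mem (S₁.comp_mem_one hX hψ) (N : ℝ)⁻¹) fun ω => hfg (X ω)
  have h2 := S₂.abs_E_sub_le (S₂.comp_mem_one hY hf) (S₂.comp_mem_one hY hg.isLocLip)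
    (S₂.const_mul_mem (S₂.comp_mem_one hY hψ) (N : ℝ)⁻¹) fun ω => hfg (Y ω)
  rw [S₁.E_const_mul (S₁.comp_mem_one hX hψ) (by positivity)] at h1
  rw [S₂.E_const_mul (S₂.comp_mem_one hY hψ) (by positivity)] at h2
  have h3 := h L g hg
  have h4 := (abs_sub_le_iff.1 h1).2
  have h5 := (abs_sub_le_iff.1 h2).1
  rw [div_eq_inv_mul, mul_add]
  linarith

/-- A G-normal distribution is determined by its upper and lower variances. -/
theorem IsGNormal.identDistrib (hX : IsGNormal S₁ X) (hY : IsGNormal S₂ Y)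
    (hXY : ∀ a : ℝ, S₁.E (fun ω => a * X ω ^ 2) = S₂.E (fun ω => a * Y ω ^ 2)) :
    IdentDistrib S₁ X S₂ Y := fun f hf => by
  apply le_antisymm
  · refine E_comp_le_of_forall_isLip hY.1 hX.1 (fun L g hg => ?_) hf
    simpa [heat] using heat_one_le hY hX (fun a => (hXY a).symm) hg 0
  · refine E_comp_le_of_forall_isLip hX.1 hY.1 (fun L g hg => ?_) hf
    simpa [heat] using heat_one_le hX hY hXY hg 0

end Uniqueness

open SublinearSpace

/-! ### Linear combinations of independent pairs -/

section

variable {Ω : Type*} {S : SublinearSpace Ω} {δ δ₁ M M₁ : Ω → ℝ}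

theorem IsGNormal.const_mul (hδ : IsGNormal S δ) (c : ℝ) : IsGNormal S (fun ω => c * δ ω) := by
  obtain ⟨hm, Ω', S', X, X', hX, hX', hXδ, ⟨hind, hX'X⟩, hstab⟩ := hδ
  refine ⟨S.const_mul_mem hm c, Ω', S', fun ω => c * X ω, fun ω => c * X' ω,
    S'.const_mul_mem hX c, S'.const_mul_mem hX' c, fun φ hφ => ?_, ⟨fun φ hφ => ?_, fun φ hφ => ?_⟩,
    fun a b ha hb φ hφ => ?_⟩
  · simpa using hXδ _ (hφ.comp_affine 0 c)
  · refine hind (fun p => φ (c * p.1, c * p.2))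
      (hφ.comp (fun p : ℝ × ℝ => c • p) |c| fun p q => ?_)
    rw [← smul_sub, norm_smul, Real.norm_eq_abs]
  · simpa using hX'X _ (hφ.comp_affine 0 c)
  · have := hstab a b ha hb _ (hφ.comp_affine 0 c)
    simp only [zero_add] at this
    convert this using 4 <;> ring

theorem IsGNormal.congr (hδ : IsGNormal S δ) (hm₁ : δ₁ ∈ S.H) (h : IdentDistrib S δ₁ S δ) :
    IsGNormal S δ₁ := by
  obtain ⟨hm, Ω', S', X, X', hX, hX', hXδ, hcopy, hstab⟩ := hδ
  refine ⟨hm₁, Ω', S', X, X', hX, hX', fun φ hφ => (hXδ φ hφ).trans (h φ hφ).symm, hcopy,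
    fun a b ha hb φ hφ => (hstab a b ha hb φ hφ).trans ?_⟩
  simpa using (h _ (hφ.comp_affine 0 √(a ^ 2 + b ^ 2))).symm

/-- The upper variance settles a ≥ 0 and the lower one a ≤ 0; this is the form of the hypothesis in
`IsGNormal.identDistrib`. -/
theorem IsGNormalVar.E_mul_sq_eq {v w : ℝ} (hδ : IsGNormalVar S δ v w)
    (hδ₁ : IsGNormalVar S δ₁ v w) (a : ℝ) :
    S.E (fun ω => a * δ ω ^ 2) = S.E (fun ω => a * δ₁ ω ^ 2) := by
  obtain ⟨hg, hlo, hhi⟩ := hδ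
  obtain ⟨hg₁, hlo₁, hhi₁⟩ := hδ₁
  have hm : (fun ω => δ ω ^ 2) ∈ S.H := S.comp_mem_one hg.1 (isLocLip_pow 2)
  have hm₁ : (fun ω => δ₁ ω ^ 2) ∈ S.H := S.comp_mem_one hg₁.1 (isLocLip_pow 2)
  rcases le_total 0 a with ha | ha
  · rw [S.E_const_mul hm ha, S.E_const_mul hm₁ ha, hhi, hhi₁]
  · have key : ∀ X : Ω → ℝ, X ∈ S.H →
        S.E (fun ω => a * X ω) = -a * S.E (fun ω => -X ω) := fun X hX => by
      have hX' : (fun ω => -X ω) ∈ S.H := S.H.neg_mem hX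
      rw [← S.E_const_mul hX' (neg_nonneg.2 ha)]
      simp
    rw [key _ hm, key _ hm₁]
    congr 1
    linarith

theorem IsGNormalVar.of_identDistrib {v w c : ℝ} (hδ : IsGNormalVar S δ v w) (hm₁ : δ₁ ∈ S.H)
    (h : IdentDistrib S δ₁ S (fun ω => c * δ ω)) :
    IsGNormalVar S δ₁ (c ^ 2 * v) (c ^ 2 * w) := by
  obtain ⟨hg, hlo, hhi⟩ := hδ
  have hm : (fun ω => δ ω ^ 2) ∈ S.H := S.comp_mem_one hg.1 (isLocLip_pow 2)
  refine ⟨(hg.const_mul c).congr hm₁ h, ?_, ?_⟩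
  · have h1 := h _ ((isLocLip_pow 2).const_mul (-1))
    have h2 := S.E_const_mul (S.H.neg_mem hm) (sq_nonneg c)
    simp only [neg_one_mul, mul_pow, Pi.neg_apply, mul_neg] at h1 h2
    rw [h1, h2, ← hlo]
    change _ = c ^ 2 * -S.E (-fun ω => δ ω ^ 2)
    ring
  · rw [h _ (isLocLip_pow 2), ← hhi, ← S.E_const_mul hm (sq_nonneg c)]
    simp only [mul_pow]

/-- A linear combination, with coefficients of arbitrary sign, of a G-normal variable and an
independent one with the same variances. -/
theorem IsGNormalVar.identDistrib_add {v w : ℝ} (hδ : IsGNormalVar S δ v w)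
    (hδ₁ : IsGNormalVar S δ₁ v w) (hind : IsIndepOf S δ₁ δ) (a b : ℝ) :
    IdentDistrib S (fun ω => a * δ ω + b * δ₁ ω) S (fun ω => √(a ^ 2 + b ^ 2) * δ ω) := by
  intro φ hφ
  have hscale : ∀ c e : ℝ, S.E (fun ω => e * (c * δ ω) ^ 2) = S.E (fun ω => e * (|c| * δ ω) ^ 2) :=
    fun c e => by simp only [mul_pow, sq_abs]
  -- Variances do not see the sign of a coefficient, so by uniqueness aδ and |a|δ have the same law.
  -- Writing |a| as √(a²) matches `heat` at time a².
  have ha : IdentDistrib S (fun ω => a * δ ω) S (fun ω => √(a ^ 2) * δ ω) := by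
    rw [Real.sqrt_sq_eq_abs]
    exact (hδ.1.const_mul a).identDistrib (hδ.1.const_mul |a|) (hscale a)
  have hb : IdentDistrib S (fun ω => b * δ₁ ω) S (fun ω => √(b ^ 2) * δ ω) := by
    rw [Real.sqrt_sq_eq_abs]
    refine (hδ₁.1.const_mul b).identDistrib (hδ.1.const_mul |b|) fun e => ?_
    rw [← hscale]
    simpa only [mul_pow, ← mul_assoc] using (hδ.E_mul_sq_eq hδ₁ (e * b ^ 2)).symm
  have h1 := hind.E_comp_affine hφ 0 a b
  have h2 : ∀ z, S.E (fun ω => φ (z + b * δ₁ ω)) = S.heat δ (b ^ 2) φ z := fun z => by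
    simpa only [one_mul, heat] using hb _ (hφ.comp_affine z 1)
  simp only [h2, zero_add] at h1
  rw [h1, ha _ (isLocLip_heat hδ.1.1 hφ (b ^ 2))]
  have h3 := hδ.1.heat_add hφ (sq_nonneg a) (sq_nonneg b) 0
  rw [heat, heat] at h3
  simpa only [zero_add] using h3.symm

theorem mem_Icc_combination_iff {l u a b z : ℝ} (hlu : l ≤ u) :
    z ∈ Set.Icc (l * (a⁺ + b⁺) - u * (a⁻ + b⁻)) (u * (a⁺ + b⁺) - l * (a⁻ + b⁻)) ↔
      ∃ x ∈ Set.Icc l u, ∃ y ∈ Set.Icc l u, a * x + b * y = z := by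
  constructor
  · intro hz
    -- The target z is a convex combination of the endpoints with weight s; the same s is used in
    -- both coordinates, moving along the diagonal of the square from a minimizer to a maximizer.
    have key : ∀ (c s : ℝ), 0 ≤ s → s ≤ 1 → ∃ x ∈ Set.Icc l u,
        c * x = (1 - s) * (l * c⁺ - u * c⁻) + s * (u * c⁺ - l * c⁻) := by
      intro c s h0 h1
      rcases le_total 0 c with hc | hc
      · refine ⟨(1 - s) * l + s * u, ⟨by nlinarith, by nlinarith⟩, ?_⟩
        rw [posPart_of_nonneg hc, negPart_of_nonneg hc]
        ring
      · refine ⟨(1 - s) * u + s * l, ⟨by nlinarith, by nlinarith⟩, ?_⟩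
        rw [posPart_of_nonpos hc, negPart_of_nonpos hc]
        ring
    rw [← segment_eq_Icc (hz.1.trans hz.2)] at hz
    obtain ⟨r, s, hr, hs, hrs, rfl⟩ := hz
    obtain rfl : r = 1 - s := by linarith
    obtain ⟨x, hx, hax⟩ := key a s hs (by linarith)
    obtain ⟨y, hy, hby⟩ := key b s hs (by linarith)
    refine ⟨x, hx, y, hy, ?_⟩
    rw [hax, hby]
    simp only [smul_eq_mul]
    ring
  · rintro ⟨x, hx, y, hy, rfl⟩
    have key : ∀ c, ∀ x ∈ Set.Icc l u, l * c⁺ - u * c⁻ ≤ c * x ∧ c * x ≤ u * c⁺ - l * c⁻ := by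
      intro c x hx
      have h1 := posPart_nonneg c
      have h2 := negPart_nonneg c
      have h3 : c * x = x * c⁺ - x * c⁻ := by
        rw [← mul_sub, posPart_sub_negPart, mul_comm]
      have := mul_le_mul_of_nonneg_right hx.1 h1
      have := mul_le_mul_of_nonneg_right hx.1 h2
      have := mul_le_mul_of_nonneg_right hx.2 h1
      have := mul_le_mul_of_nonneg_right hx.2 h2
      constructor <;> linarith
    have h1 := key a x hx
    have h2 := key b y hy
    constructor <;> linarith

theorem IsMaximal.add {l u : ℝ} (hM : IsMaximal S M l u) (hM₁ : IsMaximal S M₁ l u)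
    (hind : IsIndepOf S M₁ M) (a b : ℝ) :
    IsMaximal S (fun ω => a * M ω + b * M₁ ω)
      (l * (a⁺ + b⁺) - u * (a⁻ + b⁻)) (u * (a⁺ + b⁺) - l * (a⁻ + b⁻)) := by
  -- A least upper bound of the empty set does not exist in ℝ, so the interval is nonempty.
  have hlu : l ≤ u := by
    have := (hM.2 _ (isLocLip_const 0)).nonempty
    rwa [Set.image_nonempty, Set.nonempty_Icc] at this
  refine ⟨S.add_mem (S.const_mul_mem hM.1 a) (S.const_mul_mem hM₁.1 b), fun φ hφ => ?_⟩
  have h1 := hind.E_comp_affine hφ 0 a b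
  simp only [zero_add] at h1
  rw [h1]
  have hin : ∀ x, IsLUB ((fun y => φ (a * x + b * y)) '' Set.Icc l u)
      (S.E (fun ω => φ (a * x + b * M₁ ω))) := fun x => hM₁.2 _ (hφ.comp_affine (a * x) b)
  have hloc : IsLocLip (fun x => S.E (fun ω => φ (a * x + b * M₁ ω))) := by
    simpa using S.isLocLip_E hM₁.1 (hφ.comp_affine₂ 0 a b)
  have hout := hM.2 _ hloc
  constructor
  · rintro _ ⟨z, hz, rfl⟩
    obtain ⟨x, hx, y, hy, rfl⟩ := (mem_Icc_combination_iff hlu).1 hz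
    exact ((hin x).1 ⟨y, hy, rfl⟩).trans (hout.1 ⟨x, hx, rfl⟩)
  · intro c hc
    refine hout.2 ?_
    rintro _ ⟨x, hx, rfl⟩
    refine (hin x).2 ?_
    rintro _ ⟨y, hy, rfl⟩
    exact hc ⟨_, (mem_Icc_combination_iff hlu).2 ⟨x, hx, y, hy, rfl⟩, rfl⟩

end

end SublinearExp

/-! ### Assembly for multiplication by a complex number -/

theorem mainTheorem8 {Ω : Type*} (S : SublinearExp.SublinearSpace Ω)
    (Z : Ω → ℂ) (M M₁ δ δ₁ : Ω → ℝ) (μlo μhi σlo σhi : ℝ)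
    (hσlo : 0 ≤ σlo) (hσ : σlo ≤ σhi)
    (hre : ∀ ω, (Z ω).re = M ω + δ ω) (him : ∀ ω, (Z ω).im = M₁ ω + δ₁ ω)
    (hM : SublinearExp.IsMaximal S M μlo μhi) (hM₁ : SublinearExp.IsMaximal S M₁ μlo μhi)
    (hδ : SublinearExp.IsGNormalVar S δ (σlo ^ 2) (σhi ^ 2))
    (hδ₁ : SublinearExp.IsGNormalVar S δ₁ (σlo ^ 2) (σhi ^ 2))
    (hMind : SublinearExp.IsIndepOf S M₁ M) (hδind : SublinearExp.IsIndepOf S δ₁ δ)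
    (h : ℂ) :
    ∃ M' M₁' δ' δ₁' : Ω → ℝ,
      (∀ ω, (h * Z ω).re = M' ω + δ' ω) ∧
      (∀ ω, (h * Z ω).im = M₁' ω + δ₁' ω) ∧
      SublinearExp.IsGNormalVar S δ' (‖h‖ ^ 2 * σlo ^ 2) (‖h‖ ^ 2 * σhi ^ 2) ∧
      SublinearExp.IsGNormalVar S δ₁' (‖h‖ ^ 2 * σlo ^ 2) (‖h‖ ^ 2 * σhi ^ 2) ∧
      SublinearExp.IsMaximal S M'
        (μlo * (h.re⁺ + h.im⁻) - μhi * (h.re⁻ + h.im⁺))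
        (μhi * (h.re⁺ + h.im⁻) - μlo * (h.re⁻ + h.im⁺)) ∧
      SublinearExp.IsMaximal S M₁'
        (μlo * (h.re⁺ + h.im⁺) - μhi * (h.re⁻ + h.im⁻))
        (μhi * (h.re⁺ + h.im⁺) - μlo * (h.re⁻ + h.im⁻)) := by
  have hre' := fun a b : ℝ => hδ.of_identDistrib
    (S.add_mem (S.const_mul_mem hδ.1.1 a) (S.const_mul_mem hδ₁.1.1 b))
    (hδ.identDistrib_add hδ₁ hδind a b)
  have hsq : ∀ a b : ℝ, √(a ^ 2 + b ^ 2) ^ 2 = a ^ 2 + b ^ 2 := fun a b =>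
    Real.sq_sqrt (by positivity)
  have hn : ‖h‖ ^ 2 = h.re ^ 2 + h.im ^ 2 := by
    rw [Complex.sq_norm, Complex.normSq_apply]
    ring
  refine ⟨fun ω => h.re * M ω + -h.im * M₁ ω, fun ω => h.im * M ω + h.re * M₁ ω,
    fun ω => h.re * δ ω + -h.im * δ₁ ω, fun ω => h.im * δ ω + h.re * δ₁ ω,
    fun ω => ?_, fun ω => ?_, ?_, ?_, ?_, ?_⟩
  · rw [Complex.mul_re, hre, him]
    ring
  · rw [Complex.mul_im, hre, him]
    ring
  · have := hre' h.re (-h.im)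
    rwa [hsq, neg_sq, ← hn] at this
  · have := hre' h.im h.re
    rwa [hsq, add_comm, ← hn] at this
  · have := hM.add hM₁ hMind h.re (-h.im)
    -- The coefficient `-h.im` exchanges positive and negative parts, which is why h₂⁻ accompanies
    -- h₁⁺ in the real part.
    rwa [posPart_neg, negPart_neg] at this
  · have := hM.add hM₁ hMind h.im h.re
    rwa [add_comm h.im⁺, add_comm h.im⁻] at this
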